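/- Let $\Gamma=\{(A(1),C(1)),\dots,(A(l),C(l))\}$ be a finite set of modes, $A(i)\in\mathbb{R}^{n\times n}$, $C(i)\in\mathbb{R}^{m\times n}$, and let $(A_k,C_k)=(A(\sigma_k),C(\sigma_k))$, $k\ge 0$, be a random sequence of modes, $\sigma_k\in\{1,\dots,l\}$. Let $\Lambda^i\subset\mathbb{C}$ be the set of eigenvalues of $A(i)$. Assume that the following design recommendations hold: (1) $\Lambda^i\cap\Lambda^j=\emptyset$ for all $i\ne j$; (2) there is an integer $\kappa\ge 2n$ such that, almost surely, $(A_{k+1},C_{k+1})=(A_k,C_k)$ whenever $\kappa\nmid k+1$ (the matrices can change only every $\kappa$ time steps); (3) for every fixed sequence $(l_k)_{k\ge0}$ in $\{1,\dots,l\}$ and every fixed strictly increasing sequence of times $(\varrho_k)_{k\ge0}$, $\Pr\big((A_{\varrho_k},C_{\varrho_k})=(A(l_k),C(l_k))\ \forall k\big)=0$; (4) $(A(i),C(i))$ is observable for every $i$; (5) $0\notin\Lambda^i$ for every $i$. Consider the stochastic system $x_{k+1}=A_kx_k+w_k$, $y_k=C_kx_k+D^ad^a_k+v_k$, with process noise covariance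 $Q\succeq0$, sensor noise covariance $R\succ0$ and initial covariance $P_{0|-1}\succeq0$, where $D^a\in\{0,1\}^{m\times r}$ is the matrix with $D^a_{uv}=1$ if and only if $u=s_v$, for a list $s_1,\dots,s_r$ of distinct attacked sensors, and where the (deterministic or random) attack sequence $(d^a_k)_{k\ge0}$ in $\mathbb{R}^r$ is independent of the mode sequence $(\sigma_k)_{k\ge0}$. Let $$K_k=P_{k|k-1}C_k^T(C_kP_{k|k-1}C_k^T+R)^{-1},\qquad P_{k+1|k}=A_k(I-K_kC_k)P_{k|k-1}A_k^T+Q$$ be the gain and the a priori error covariance of the Kalman filter. The attack induces the bias $\Delta e_k$ on the a posteriori state estimation error and the bias $\Delta z_k$ on the normalized residue, given for $k\ge0$ by $$\Delta e_k=(A_{k-1}-K_kC_kA_{k-1})\Delta e_{k-1}-K_kD^ad^a_k,\qquad \Delta z_k=(C_kP_{k|k-1}C_k^T+R)^{-1/2}\big(C_kA_{k-1}\Delta e_{k-1}+D^ad^a_k\big),\qquad \Delta e_{-1}=0.$$ Then, with probability $1$, $$\limsup_{k\to\infty}\|\Delta e_k\|=\infty\ \Longrightarrow\ \limsup_{k\to\infty}\|\Delta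 z_k\|=\infty .$$ -/

import Mathlib

open MeasureTheory ProbabilityTheory Filter Matrix
open scoped ENNReal MatrixOrder

namespace HybridMovingTarget

noncomputable section

/-- The observability matrix `[C; C A; …; C A ^ (n - 1)]` of the pair `(A, C)`; its rows are indexed
by a power `t < n` and a sensor `s`. -/
def observabilityMatrix {n m : ℕ} (A : Matrix (Fin n) (Fin n) ℝ) (C : Matrix (Fin m) (Fin n) ℝ) :
    Matrix (Fin n × Fin m) (Fin n) ℝ :=
  Matrix.of fun p j => (C * A ^ (p.1 : ℕ)) p.2 j

/-- The pair `(A, C)` is observable: the observability matrix has full column rank. -/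
def IsObservable {n m : ℕ} (A : Matrix (Fin n) (Fin n) ℝ) (C : Matrix (Fin m) (Fin n) ℝ) : Prop :=
  (observabilityMatrix A C).rank = n

/-- The set of distinct complex eigenvalues of a real matrix. -/
def eigenvalueSet {n : ℕ} (A : Matrix (Fin n) (Fin n) ℝ) : Set ℂ :=
  spectrum ℂ (A.map ((↑) : ℝ → ℂ))

/-- The design recommendations for a hybrid moving target with modes `(A i, C i)`, whose mode at
time `k` is the random index `σ k`. -/
structure DesignRecommendations {Ω : Type*} [MeasurableSpace Ω] (P : Measure Ω) {n m l : ℕ}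
    (A : Fin l → Matrix (Fin n) (Fin n) ℝ) (C : Fin l → Matrix (Fin m) (Fin n) ℝ)
    (σ : ℕ → Ω → Fin l) : Prop where
  /-- Distinct modes have no common eigenvalue. -/
  disjoint_eigenvalues : ∀ i j, i ≠ j → eigenvalueSet (A i) ∩ eigenvalueSet (A j) = ∅
  /-- The matrices can only change at the multiples of a period `κ ≥ 2 n`. -/
  periodic_change : ∃ κ : ℕ, 2 * n ≤ κ ∧ ∀ᵐ ω ∂P, ∀ k : ℕ, ¬ κ ∣ (k + 1) →
    (A (σ (k + 1) ω), C (σ (k + 1) ω)) = (A (σ k ω), C (σ k ω))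
  /-- No prescribed sequence of modes is followed along a prescribed infinite subsequence of times,
  except with probability zero. -/
  unpredictable : ∀ (g : ℕ → Fin l) (ρ : ℕ → ℕ), StrictMono ρ →
    P {ω | ∀ k, (A (σ (ρ k) ω), C (σ (ρ k) ω)) = (A (g k), C (g k))} = 0
  /-- Every mode is observable. -/
  observable : ∀ i, IsObservable (A i) (C i)
  /-- No mode has the eigenvalue zero. -/
  zero_notMem_eigenvalues : ∀ i, (0 : ℂ) ∉ eigenvalueSet (A i)

/-- The matrix `Dᵃ` of an attack on the ordered set of distinct sensors `s 0, s 1, …`. -/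
def attackMatrix {m r : ℕ} (s : Fin r ↪ Fin m) : Matrix (Fin m) (Fin r) ℝ :=
  Matrix.of fun u v => if u = s v then 1 else 0

/-- The covariance `C P Cᵀ + R` of the residue, for the a priori error covariance `P`. -/
def innovationCov {n m : ℕ} (C : Matrix (Fin m) (Fin n) ℝ) (R : Matrix (Fin m) (Fin m) ℝ)
    (P : Matrix (Fin n) (Fin n) ℝ) : Matrix (Fin m) (Fin m) ℝ :=
  C * P * Cᵀ + R

/-- The Kalman gain `P Cᵀ (C P Cᵀ + R)⁻¹`, for the a priori error covariance `P`. -/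
def kalmanGain {n m : ℕ} (C : Matrix (Fin m) (Fin n) ℝ) (R : Matrix (Fin m) (Fin m) ℝ)
    (P : Matrix (Fin n) (Fin n) ℝ) : Matrix (Fin n) (Fin m) ℝ :=
  P * Cᵀ * (innovationCov C R P)⁻¹

section Filter

variable {n m r : ℕ} (A : ℕ → Matrix (Fin n) (Fin n) ℝ) (C : ℕ → Matrix (Fin m) (Fin n) ℝ)
  (Q : Matrix (Fin n) (Fin n) ℝ) (R : Matrix (Fin m) (Fin m) ℝ) (P₀ : Matrix (Fin n) (Fin n) ℝ)
  (D : Matrix (Fin m) (Fin r) ℝ) (d : ℕ → Fin r → ℝ)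

/-- The a priori error covariance `P_{k|k-1}` of the Kalman filter, with `P_{0|-1} = P₀`. -/
def priorCov : ℕ → Matrix (Fin n) (Fin n) ℝ
  | 0 => P₀
  | k + 1 => A k * (1 - kalmanGain (C k) R (priorCov k) * C k) * priorCov k * (A k)ᵀ + Q

/-- The Kalman gain `K_k` at time `k`. -/
def gain (k : ℕ) : Matrix (Fin n) (Fin m) ℝ :=
  kalmanGain (C k) R (priorCov A C Q R P₀ k)

/-- The bias `Δe_k` on the a posteriori state estimation error:
`Δe_k = (A_{k-1} - K_k C_k A_{k-1}) Δe_{k-1} - K_k D d_k` with `Δe_{-1} = 0`. -/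
def errorBias : ℕ → Fin n → ℝ
  | 0 => -(gain A C Q R P₀ 0 *ᵥ (D *ᵥ d 0))
  | k + 1 => (A k - gain A C Q R P₀ (k + 1) * C (k + 1) * A k) *ᵥ errorBias k
      - gain A C Q R P₀ (k + 1) *ᵥ (D *ᵥ d (k + 1))

/-- The bias on the unnormalized residue: `C_k A_{k-1} Δe_{k-1} + D d_k` with `Δe_{-1} = 0`. -/
def rawResidueBias : ℕ → Fin m → ℝ
  | 0 => D *ᵥ d 0
  | k + 1 => (C (k + 1) * A k) *ᵥ errorBias A C Q R P₀ D d k + D *ᵥ d (k + 1)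

/-- The bias `Δz_k` on the normalized residue:
`Δz_k = (C_k P_{k|k-1} C_kᵀ + R)^{-1/2} (C_k A_{k-1} Δe_{k-1} + D d_k)` with `Δe_{-1} = 0`. -/
def residueBias (k : ℕ) : Fin m → ℝ :=
  (CFC.sqrt (innovationCov (C k) R (priorCov A C Q R P₀ k)))⁻¹ *ᵥ rawResidueBias A C Q R P₀ D d k

end Filter

/-- The limit superior of the Euclidean norms of a sequence of vectors is `∞`. -/
def LimsupNormEqTop {n : ℕ} (x : ℕ → Fin n → ℝ) : Prop :=
  limsup (fun k => ‖(WithLp.toLp 2 (x k) : EuclideanSpace ℝ (Fin n))‖ₑ) atTop = (⊤ : ℝ≥0∞)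

end

end HybridMovingTarget

/-! The argument is pathwise and by contradiction: suppose `Δz` is bounded while `Δe` is not.
Observability keeps the Kalman covariance bounded (`exists_priorCov_le`), so the filter makes only
bounded corrections: up to bounded errors, `Δe` follows `x ↦ A x` and `D d_k` equals `-C_k Δe_k`
(`exists_bound_of_residueBias_bounded`). Hence the attack over the `2 n` steps from time `κ j` stays
within a fixed distance of the space of output sequences of the current mode
(`exists_norm_attackWindow_add_outputs_le`). Since `Δe` is unbounded, infinitely many of these
windows exceed any given size (`frequently_lt_norm_attackWindow`).

Disjoint spectra make the output spaces of two distinct modes meet only in zero, so a window close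
to both is bounded (`exists_norm_le_of_infDist_le`). A large window therefore reveals the mode: the
attack alone determines the modes along an infinite sequence of times. For a fixed attack this has
probability zero by unpredictability; independence and Fubini extend this to random attacks
(`measure_stealthySet_eq_zero`). Integer error levels leave only countably many null events. -/

namespace HybridMovingTarget

/-! ### Norm bounds from the Loewner order and matrix square roots. -/

section Loewner

variable {n m : ℕ}

lemma posSemidef_conj {P : Matrix (Fin n) (Fin n) ℝ} (hP : P.PosSemidef)
    (B : Matrix (Fin m) (Fin n) ℝ) : (B * P * Bᵀ).PosSemidef := by
  simpa [conjTranspose_eq_transpose_of_trivial] using hP.mul_mul_conjTranspose_same B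

lemma conj_mono {P X : Matrix (Fin n) (Fin n) ℝ} (h : P ≤ X) (B : Matrix (Fin m) (Fin n) ℝ) :
    B * P * Bᵀ ≤ B * X * Bᵀ := by
  rw [Matrix.le_iff] at h ⊢
  simpa [Matrix.mul_sub, Matrix.sub_mul] using posSemidef_conj h B

lemma dotProduct_mulVec_mono {P X : Matrix (Fin n) (Fin n) ℝ} (h : P ≤ X) (v : Fin n → ℝ) :
    v ⬝ᵥ P *ᵥ v ≤ v ⬝ᵥ X *ᵥ v := by
  have := (Matrix.le_iff.1 h).dotProduct_mulVec_nonneg v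
  simpa [sub_mulVec, dotProduct_sub] using this

/-- Test the quadratic form on the sum and the difference of two basis vectors. -/
lemma abs_apply_le_of_posSemidef {P : Matrix (Fin n) (Fin n) ℝ} (hP : P.PosSemidef) (i j : Fin n) :
    |P i j| ≤ P i i + P j j := by
  have hs : P j i = P i j := by simpa using hP.1.apply i j
  have h1 := hP.dotProduct_mulVec_nonneg (Pi.single i 1 + Pi.single j 1)
  have h2 := hP.dotProduct_mulVec_nonneg (Pi.single i 1 - Pi.single j 1)
  simp only [star_trivial, mulVec_add, mulVec_sub, add_dotProduct, sub_dotProduct, dotProduct_add,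
    dotProduct_sub, mulVec_single_one, single_one_dotProduct, col_apply, hs] at h1 h2
  have h3 := hP.diag_nonneg (i := i)
  have h4 := hP.diag_nonneg (i := j)
  rw [abs_le]
  constructor <;> linarith

lemma abs_apply_le_of_le {P X : Matrix (Fin n) (Fin n) ℝ} (hP : P.PosSemidef) (h : P ≤ X)
    (i j : Fin n) : |P i j| ≤ 2 * X.trace := by
  have hd : ∀ i, P i i ≤ X i i := fun i => by
    have := (Matrix.le_iff.1 h).diag_nonneg (i := i)
    simpa using this
  have ht : ∀ i, P i i ≤ X.trace := fun i =>
    (hd i).trans (Finset.single_le_sum (f := fun i => X i i)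
      (fun k _ => (hP.diag_nonneg).trans (hd k)) (Finset.mem_univ i))
  linarith [abs_apply_le_of_posSemidef hP i j, ht i, ht j]

/-- The constant depends on `X` only, so it serves all covariances `P_{k|k-1}` at once. -/
lemma exists_norm_mulVec_le_of_le (X : Matrix (Fin n) (Fin n) ℝ) :
    ∃ c : ℝ, ∀ P : Matrix (Fin n) (Fin n) ℝ, P.PosSemidef → P ≤ X →
      ∀ v, ‖P *ᵥ v‖ ≤ c * ‖v‖ := by
  refine ⟨∑ _j : Fin n, |2 * X.trace|, fun P hP h v => ?_⟩
  refine (pi_norm_le_iff_of_nonneg (by positivity)).2 fun i => ?_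
  rw [mulVec, dotProduct, Finset.sum_mul]
  refine (norm_sum_le _ _).trans (Finset.sum_le_sum fun j _ => ?_)
  rw [norm_mul]
  exact mul_le_mul ((abs_apply_le_of_le hP h i j).trans (le_abs_self _)) (norm_le_pi_norm v j)
    (norm_nonneg _) (abs_nonneg _)

lemma exists_norm_mulVec_le (B : Matrix (Fin m) (Fin n) ℝ) :
    ∃ c : ℝ, 0 ≤ c ∧ ∀ v, ‖B *ᵥ v‖ ≤ c * ‖v‖ :=
  ⟨‖(Matrix.mulVecLin B).toContinuousLinearMap‖, norm_nonneg _,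
    (Matrix.mulVecLin B).toContinuousLinearMap.le_opNorm⟩

lemma exists_norm_mulVec_le_of_finite {l : ℕ} (B : Fin l → Matrix (Fin m) (Fin n) ℝ) :
    ∃ c : ℝ, 0 ≤ c ∧ ∀ i v, ‖B i *ᵥ v‖ ≤ c * ‖v‖ := by
  choose c hc h using fun i => exists_norm_mulVec_le (B i)
  refine ⟨∑ i, c i, Finset.sum_nonneg fun i _ => hc i, fun i v => (h i v).trans ?_⟩
  gcongr
  exact Finset.single_le_sum (f := c) (fun i _ => hc i) (Finset.mem_univ i)

lemma norm_sq_le_dotProduct (v : Fin n → ℝ) : ‖v‖ ^ 2 ≤ v ⬝ᵥ v := by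
  have h0 : 0 ≤ v ⬝ᵥ v := Finset.sum_nonneg fun i _ => mul_self_nonneg (v i)
  have : ‖v‖ ≤ √(v ⬝ᵥ v) := by
    refine (pi_norm_le_iff_of_nonneg (Real.sqrt_nonneg _)).2 fun i => ?_
    refine Real.le_sqrt_of_sq_le ?_
    rw [Real.norm_eq_abs, sq_abs, pow_two]
    exact Finset.single_le_sum (f := fun i => v i * v i) (fun i _ => mul_self_nonneg (v i))
      (Finset.mem_univ i)
  calc ‖v‖ ^ 2 ≤ √(v ⬝ᵥ v) ^ 2 := by gcongr
    _ = _ := Real.sq_sqrt h0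

lemma dotProduct_le_norm_mul_norm (v w : Fin n → ℝ) : v ⬝ᵥ w ≤ n * (‖v‖ * ‖w‖) := by
  have : ∑ i, v i * w i ≤ ∑ _i : Fin n, ‖v‖ * ‖w‖ := Finset.sum_le_sum fun i _ =>
    (le_abs_self _).trans (by
      rw [abs_mul]
      exact mul_le_mul (norm_le_pi_norm v i) (norm_le_pi_norm w i) (abs_nonneg _) (norm_nonneg _))
  simpa [dotProduct] using this

lemma sqrt_mul_self_of_posSemidef {S : Matrix (Fin n) (Fin n) ℝ} (hS : S.PosSemidef) :
    CFC.sqrt S * CFC.sqrt S = S :=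
  CFC.sqrt_mul_sqrt_self S (Matrix.nonneg_iff_posSemidef.2 hS)

lemma transpose_sqrt (S : Matrix (Fin n) (Fin n) ℝ) : (CFC.sqrt S)ᵀ = CFC.sqrt S := by
  have := (Matrix.nonneg_iff_posSemidef.1 (CFC.sqrt_nonneg S)).1
  rwa [IsHermitian, conjTranspose_eq_transpose_of_trivial] at this

lemma isUnit_sqrt {S : Matrix (Fin n) (Fin n) ℝ} (hS : S.PosDef) : IsUnit (CFC.sqrt S) := by
  have h := hS.isUnit
  rw [← sqrt_mul_self_of_posSemidef hS.posSemidef] at h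
  exact isUnit_of_mul_isUnit_left h

lemma sqrt_mulVec_dotProduct {S : Matrix (Fin n) (Fin n) ℝ} (hS : S.PosSemidef) (v : Fin n → ℝ) :
    (CFC.sqrt S *ᵥ v) ⬝ᵥ (CFC.sqrt S *ᵥ v) = v ⬝ᵥ S *ᵥ v := by
  conv_rhs => rw [← sqrt_mul_self_of_posSemidef hS]
  rw [← mulVec_mulVec, dotProduct_mulVec v, ← mulVec_transpose, transpose_sqrt]

/-- A positive definite quadratic form dominates the norm. -/
lemma exists_norm_sq_le_of_posDef {R : Matrix (Fin n) (Fin n) ℝ} (hR : R.PosDef) :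
    ∃ c : ℝ, 0 ≤ c ∧ ∀ v, ‖v‖ ^ 2 ≤ c * (v ⬝ᵥ R *ᵥ v) := by
  obtain ⟨c, hc, h⟩ := exists_norm_mulVec_le (CFC.sqrt R)⁻¹
  refine ⟨c ^ 2, by positivity, fun v => ?_⟩
  have hu := (Matrix.isUnit_iff_isUnit_det _).1 (isUnit_sqrt hR)
  have h1 := h (CFC.sqrt R *ᵥ v)
  rw [mulVec_mulVec, nonsing_inv_mul _ hu, one_mulVec] at h1
  rw [← sqrt_mulVec_dotProduct hR.posSemidef]
  calc ‖v‖ ^ 2 ≤ (c * ‖CFC.sqrt R *ᵥ v‖) ^ 2 := by gcongr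
    _ = c ^ 2 * ‖CFC.sqrt R *ᵥ v‖ ^ 2 := by ring
    _ ≤ _ := by gcongr; exact norm_sq_le_dotProduct _

end Loewner

/-! ### Deadbeat gains for an observable pair. -/

section Deadbeat

variable {n m : ℕ}

/-- Every matrix has a generalized inverse. -/
lemma exists_generalized_inverse {p q : ℕ} (N : Matrix (Fin p) (Fin q) ℝ) :
    ∃ G : Matrix (Fin q) (Fin p) ℝ, N * G * N = N := by
  obtain ⟨g, hg⟩ := LinearMap.exists_rightInverse_of_surjective (Matrix.toLin' N).rangeRestrict
    (LinearMap.range_rangeRestrict _)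
  obtain ⟨g', hg'⟩ := LinearMap.exists_extend g
  refine ⟨LinearMap.toMatrix' g', ?_⟩
  apply Matrix.toLin'.injective
  rw [toLin'_mul, toLin'_mul, toLin'_toMatrix']
  refine LinearMap.ext fun x => ?_
  have h2 := congrArg Subtype.val (LinearMap.congr_fun hg ((Matrix.toLin' N).rangeRestrict x))
  rw [← hg'] at h2
  exact h2

/-- The transition matrix over the first `t` steps of the filter with gains `K`. -/
def transition (A : Matrix (Fin n) (Fin n) ℝ) (C : Matrix (Fin m) (Fin n) ℝ)
    (K : ℕ → Matrix (Fin n) (Fin m) ℝ) : ℕ → Matrix (Fin n) (Fin n) ℝ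
  | 0 => 1
  | t + 1 => A * (1 - K t * C) * transition A C K t

lemma transition_congr (A : Matrix (Fin n) (Fin n) ℝ) (C : Matrix (Fin m) (Fin n) ℝ)
    {K K' : ℕ → Matrix (Fin n) (Fin m) ℝ} (t : ℕ) (h : ∀ s < t, K s = K' s) :
    transition A C K t = transition A C K' t := by
  induction t with
  | zero => rfl
  | succ t ih =>
    rw [transition, transition, h t (by omega), ih fun s hs => h s (by omega)]

/-- Each gain is chosen greedily to remove whatever the current output still sees. After `n` steps
the columns of `G` are unobservable, hence zero. -/
lemma exists_transition_eq (A : Matrix (Fin n) (Fin n) ℝ) (C : Matrix (Fin m) (Fin n) ℝ) (t : ℕ) :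
    ∃ (K : ℕ → Matrix (Fin n) (Fin m) ℝ) (G : Matrix (Fin n) (Fin n) ℝ),
      transition A C K t = A ^ t * G ∧ ∀ s < t, C * A ^ s * G = 0 := by
  induction t with
  | zero => exact ⟨0, 1, by simp [transition], by simp⟩
  | succ t ih =>
    obtain ⟨K, G, h, h0⟩ := ih
    -- With gain `A ^ t * G * N`, `G` becomes `G * (1 - N * (C * A ^ t * G))`, which `C * A ^ t`
    -- kills because `N` is a generalized inverse.
    obtain ⟨N, hN⟩ := exists_generalized_inverse (C * A ^ t * G)
    refine ⟨Function.update K t (A ^ t * G * N), G * (1 - N * (C * A ^ t * G)), ?_, fun s hs => ?_⟩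
    · have hc : transition A C (Function.update K t (A ^ t * G * N)) t = transition A C K t :=
        transition_congr A C t fun s hs => Function.update_of_ne hs.ne _ _
      rw [transition, hc, h, Function.update_self, pow_succ']
      simp only [Matrix.mul_sub, Matrix.sub_mul, Matrix.mul_one, Matrix.mul_assoc]
    · rw [← Matrix.mul_assoc]
      rcases Nat.lt_succ_iff_lt_or_eq.1 hs with hs | rfl
      · rw [h0 s hs, Matrix.zero_mul]
      · rw [Matrix.mul_sub, Matrix.mul_one, ← Matrix.mul_assoc, hN, sub_self]

lemma IsObservable.eq_zero {A : Matrix (Fin n) (Fin n) ℝ} {C : Matrix (Fin m) (Fin n) ℝ}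
    (h : IsObservable A C) {x : Fin n → ℝ} (hx : ∀ t < n, (C * A ^ t) *ᵥ x = 0) : x = 0 := by
  have h1 := LinearMap.finrank_range_add_finrank_ker (observabilityMatrix A C).mulVecLin
  have h2 : Module.finrank ℝ (observabilityMatrix A C).mulVecLin.range = n := h
  rw [h2, Module.finrank_fin_fun] at h1
  have h3 : (observabilityMatrix A C).mulVecLin.ker = ⊥ := Submodule.finrank_eq_zero.1 (by omega)
  have h4 : x ∈ (observabilityMatrix A C).mulVecLin.ker := by
    rw [LinearMap.mem_ker]
    ext p
    exact congrFun (hx p.1 p.1.2) p.2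
  rw [h3] at h4
  simpa using h4

/-- An observable pair admits gains that drive the estimation error to zero in `n` steps. -/
lemma IsObservable.exists_transition_eq_zero {A : Matrix (Fin n) (Fin n) ℝ}
    {C : Matrix (Fin m) (Fin n) ℝ} (h : IsObservable A C) :
    ∃ K : ℕ → Matrix (Fin n) (Fin m) ℝ, transition A C K n = 0 := by
  obtain ⟨K, G, hK, hG⟩ := exists_transition_eq A C n
  refine ⟨K, ?_⟩
  have : G = 0 := by
    ext i j
    have := h.eq_zero (x := G *ᵥ Pi.single j 1) fun t ht => by
      rw [mulVec_mulVec, hG t ht, zero_mulVec]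
    simpa using congrFun this i
  rw [hK, this, mul_zero]

end Deadbeat

/-! ### Riccati recursion and optimality of the Kalman gain. -/

section Riccati

variable {n m : ℕ}

/-- The covariance update of a filter with an arbitrary gain `K`, in Joseph form. -/
def josephUpdate (A : Matrix (Fin n) (Fin n) ℝ) (C : Matrix (Fin m) (Fin n) ℝ)
    (Q : Matrix (Fin n) (Fin n) ℝ) (R : Matrix (Fin m) (Fin m) ℝ) (K : Matrix (Fin n) (Fin m) ℝ)
    (P : Matrix (Fin n) (Fin n) ℝ) : Matrix (Fin n) (Fin n) ℝ :=
  (A * (1 - K * C)) * P * (A * (1 - K * C))ᵀ + (A * K) * R * (A * K)ᵀ + Q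

lemma transpose_of_posSemidef {P : Matrix (Fin n) (Fin n) ℝ} (hP : P.PosSemidef) : Pᵀ = P := by
  have := hP.1
  rwa [IsHermitian, conjTranspose_eq_transpose_of_trivial] at this

lemma posDef_innovationCov (C : Matrix (Fin m) (Fin n) ℝ) {R : Matrix (Fin m) (Fin m) ℝ}
    (hR : R.PosDef) {P : Matrix (Fin n) (Fin n) ℝ} (hP : P.PosSemidef) :
    (innovationCov C R P).PosDef :=
  PosDef.posSemidef_add (posSemidef_conj hP C) hR

/-- Completion of the square: any gain exceeds the Kalman gain by a square. -/
lemma josephUpdate_eq (A : Matrix (Fin n) (Fin n) ℝ) (C : Matrix (Fin m) (Fin n) ℝ)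
    (Q : Matrix (Fin n) (Fin n) ℝ) {R : Matrix (Fin m) (Fin m) ℝ} (hR : R.PosDef)
    {P : Matrix (Fin n) (Fin n) ℝ} (hP : P.PosSemidef) (K : Matrix (Fin n) (Fin m) ℝ) :
    josephUpdate A C Q R K P =
      (A * (1 - kalmanGain C R P * C) * P * Aᵀ + Q) +
        (A * (K - kalmanGain C R P)) * innovationCov C R P * (A * (K - kalmanGain C R P))ᵀ := by
  set S := innovationCov C R P with hS
  have hSd : S.PosDef := posDef_innovationCov C hR hP
  set L := kalmanGain C R P with hL
  have hLS : L * S = P * Cᵀ := by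
    rw [hL, kalmanGain, ← hS, Matrix.mul_assoc, nonsing_inv_mul _
      ((Matrix.isUnit_iff_isUnit_det _).1 hSd.isUnit), Matrix.mul_one]
  have hSL : S * Lᵀ = C * P := by
    have := congrArg Matrix.transpose hLS
    simpa [transpose_of_posSemidef hP, transpose_of_posSemidef hSd.posSemidef] using this
  have hR' : R = S - C * P * Cᵀ := by rw [hS, innovationCov]; abel
  have e1 : (K - L) * S * (K - L)ᵀ = K * S * Kᵀ - K * (C * P) - P * Cᵀ * Kᵀ + L * (C * P) := by
    rw [transpose_sub, Matrix.sub_mul, Matrix.mul_sub, Matrix.sub_mul, Matrix.sub_mul,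
      Matrix.mul_assoc K S Lᵀ, Matrix.mul_assoc L S Lᵀ, hSL, hLS]
    abel
  have e2 : (1 - K * C) * P * (1 - K * C)ᵀ + K * R * Kᵀ =
      (1 - L * C) * P + (K - L) * S * (K - L)ᵀ := by
    rw [e1, hR']
    simp only [transpose_sub, transpose_one, transpose_mul]
    simp only [Matrix.mul_sub, Matrix.sub_mul, Matrix.mul_one,
      Matrix.one_mul, Matrix.mul_assoc]
    abel
  have e3 : josephUpdate A C Q R K P =
      A * ((1 - K * C) * P * (1 - K * C)ᵀ + K * R * Kᵀ) * Aᵀ + Q := by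
    simp only [josephUpdate, transpose_mul]
    simp only [Matrix.mul_sub, Matrix.sub_mul, Matrix.mul_add, Matrix.add_mul, Matrix.mul_one,
      Matrix.one_mul, Matrix.mul_assoc]
  rw [e3, e2]
  simp only [transpose_mul]
  simp only [Matrix.mul_sub, Matrix.sub_mul, Matrix.mul_add, Matrix.add_mul, Matrix.mul_one,
      Matrix.one_mul, Matrix.mul_assoc]
  abel

lemma josephUpdate_kalmanGain (A : Matrix (Fin n) (Fin n) ℝ) (C : Matrix (Fin m) (Fin n) ℝ)
    (Q : Matrix (Fin n) (Fin n) ℝ) {R : Matrix (Fin m) (Fin m) ℝ} (hR : R.PosDef)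
    {P : Matrix (Fin n) (Fin n) ℝ} (hP : P.PosSemidef) :
    A * (1 - kalmanGain C R P * C) * P * Aᵀ + Q = josephUpdate A C Q R (kalmanGain C R P) P := by
  simp [josephUpdate_eq A C Q hR hP]

lemma posSemidef_josephUpdate (A : Matrix (Fin n) (Fin n) ℝ) (C : Matrix (Fin m) (Fin n) ℝ)
    {Q : Matrix (Fin n) (Fin n) ℝ} (hQ : Q.PosSemidef) {R : Matrix (Fin m) (Fin m) ℝ}
    (hR : R.PosDef) {P : Matrix (Fin n) (Fin n) ℝ} (hP : P.PosSemidef)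
    (K : Matrix (Fin n) (Fin m) ℝ) : (josephUpdate A C Q R K P).PosSemidef :=
  ((posSemidef_conj hP _).add (posSemidef_conj hR.posSemidef _)).add hQ

variable {A : ℕ → Matrix (Fin n) (Fin n) ℝ} {C : ℕ → Matrix (Fin m) (Fin n) ℝ}
  {Q : Matrix (Fin n) (Fin n) ℝ} {R : Matrix (Fin m) (Fin m) ℝ} {P₀ : Matrix (Fin n) (Fin n) ℝ}

lemma posSemidef_priorCov (hQ : Q.PosSemidef) (hR : R.PosDef) (hP₀ : P₀.PosSemidef) (k : ℕ) :
    (priorCov A C Q R P₀ k).PosSemidef := by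
  induction k with
  | zero => exact hP₀
  | succ k ih =>
    rw [priorCov, josephUpdate_kalmanGain _ _ _ hR ih]
    exact posSemidef_josephUpdate _ _ hQ hR ih _

/-- The Kalman gain minimizes the Joseph update, and for a fixed gain that update is monotone in the
covariance. Any convenient gain thus yields an upper bound. -/
lemma priorCov_succ_le (hQ : Q.PosSemidef) (hR : R.PosDef) (hP₀ : P₀.PosSemidef) (k : ℕ)
    {X : Matrix (Fin n) (Fin n) ℝ} (h : priorCov A C Q R P₀ k ≤ X) (K : Matrix (Fin n) (Fin m) ℝ) :
    priorCov A C Q R P₀ (k + 1) ≤ josephUpdate (A k) (C k) Q R K X := by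
  have hP := posSemidef_priorCov (A := A) (C := C) hQ hR hP₀ k
  have h1 : priorCov A C Q R P₀ (k + 1) ≤
      josephUpdate (A k) (C k) Q R K (priorCov A C Q R P₀ k) := by
    rw [priorCov, josephUpdate_eq _ _ _ hR hP K]
    exact le_add_of_nonneg_right (Matrix.nonneg_iff_posSemidef.2
      (posSemidef_conj (posDef_innovationCov _ hR hP).posSemidef _))
  refine h1.trans ?_
  unfold josephUpdate
  gcongr
  exact conj_mono h _

/-- The covariance accumulated by the noise over `t` steps with gains `K`. -/
def accumulatedCov (A : Matrix (Fin n) (Fin n) ℝ) (C : Matrix (Fin m) (Fin n) ℝ)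
    (Q : Matrix (Fin n) (Fin n) ℝ) (R : Matrix (Fin m) (Fin m) ℝ)
    (K : ℕ → Matrix (Fin n) (Fin m) ℝ) : ℕ → Matrix (Fin n) (Fin n) ℝ
  | 0 => 0
  | t + 1 => josephUpdate A C Q R (K t) (accumulatedCov A C Q R K t)

lemma posSemidef_accumulatedCov (A : Matrix (Fin n) (Fin n) ℝ) (C : Matrix (Fin m) (Fin n) ℝ)
    (hQ : Q.PosSemidef) (hR : R.PosDef) (K : ℕ → Matrix (Fin n) (Fin m) ℝ) (t : ℕ) :
    (accumulatedCov A C Q R K t).PosSemidef := by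
  induction t with
  | zero => exact PosSemidef.zero
  | succ t ih => exact posSemidef_josephUpdate _ _ hQ hR ih _

lemma priorCov_add_le (hQ : Q.PosSemidef) (hR : R.PosDef) (hP₀ : P₀.PosSemidef) (k : ℕ)
    (K : ℕ → Matrix (Fin n) (Fin m) ℝ) (t : ℕ)
    (h : ∀ s < t, A (k + s) = A k ∧ C (k + s) = C k) :
    priorCov A C Q R P₀ (k + t) ≤
      transition (A k) (C k) K t * priorCov A C Q R P₀ k * (transition (A k) (C k) K t)ᵀ +
        accumulatedCov (A k) (C k) Q R K t := by
  induction t with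
  | zero => simp [transition, accumulatedCov]
  | succ t ih =>
    have h1 := priorCov_succ_le hQ hR hP₀ (k + t) (ih fun s hs => h s (by omega)) (K t)
    rw [(h t (by omega)).1, (h t (by omega)).2] at h1
    refine h1.trans (le_of_eq ?_)
    simp only [josephUpdate, transition, accumulatedCov, transpose_mul]
    simp only [Matrix.mul_sub, Matrix.sub_mul, Matrix.mul_add, Matrix.add_mul, Matrix.mul_one,
      Matrix.mul_assoc]
    abel

end Riccati

/-! ### Outputs of modes with disjoint spectra. -/

section PairObservability

variable {n m : ℕ}

/-- Matrices without a common complex eigenvalue have coprime characteristic polynomials. -/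
lemma isCoprime_charpoly {A B : Matrix (Fin n) (Fin n) ℝ}
    (h : eigenvalueSet A ∩ eigenvalueSet B = ∅) : IsCoprime A.charpoly B.charpoly := by
  rw [Polynomial.isCoprime_iff_aeval_ne_zero_of_isAlgClosed ℝ ℂ]
  intro a
  by_contra! hc
  have key : ∀ M : Matrix (Fin n) (Fin n) ℝ, Polynomial.aeval a M.charpoly = 0 →
      a ∈ eigenvalueSet M := by
    intro M hM
    rw [eigenvalueSet, mem_spectrum_iff_isRoot_charpoly]
    have : (M.map ((↑) : ℝ → ℂ)).charpoly = M.charpoly.map (algebraMap ℝ ℂ) :=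
      charpoly_map M (algebraMap ℝ ℂ)
    rw [this, Polynomial.IsRoot, Polynomial.eval_map_algebraMap, hM]
  exact (h ▸ (⟨key A hc.1, key B hc.2⟩ : a ∈ eigenvalueSet A ∩ eigenvalueSet B) : a ∈ (∅ : Set ℂ))

/-- The outputs over `2 n` steps of the mode `(A, C)` started at `x`. -/
def outputs (A : Matrix (Fin n) (Fin n) ℝ) (C : Matrix (Fin m) (Fin n) ℝ) :
    (Fin n → ℝ) →ₗ[ℝ] (Fin (2 * n) → Fin m → ℝ) :=
  LinearMap.pi fun t => (C * A ^ (t : ℕ)).mulVecLin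

lemma outputs_apply (A : Matrix (Fin n) (Fin n) ℝ) (C : Matrix (Fin m) (Fin n) ℝ) (x : Fin n → ℝ)
    (t : Fin (2 * n)) : outputs A C x t = (C * A ^ (t : ℕ)) *ᵥ x := rfl

lemma mulVec_aeval (A : Matrix (Fin n) (Fin n) ℝ) (C : Matrix (Fin m) (Fin n) ℝ)
    (p : Polynomial ℝ) (s : ℕ) (x : Fin n → ℝ) :
    (C * A ^ s) *ᵥ (Polynomial.aeval A p *ᵥ x) =
      ∑ t ∈ Finset.range (p.natDegree + 1), p.coeff t • ((C * A ^ (s + t)) *ᵥ x) := by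
  rw [Polynomial.aeval_eq_sum_range, mulVec_mulVec, Matrix.mul_sum, sum_mulVec]
  refine Finset.sum_congr rfl fun t _ => ?_
  rw [Matrix.mul_smul, smul_mulVec, Matrix.mul_assoc, pow_add]

/-- By Cayley–Hamilton the outputs of `B` satisfy the recurrence given by `B.charpoly`; so do those
of `A`, being equal. Observability of `A` gives `B.charpoly(A) x = 0`, and Bézout with
`A.charpoly(A) = 0` gives `x = 0`. -/
lemma eq_zero_of_outputs_eq {A B : Matrix (Fin n) (Fin n) ℝ} {C E : Matrix (Fin m) (Fin n) ℝ}
    (hA : IsObservable A C) (h : eigenvalueSet A ∩ eigenvalueSet B = ∅) {x y : Fin n → ℝ}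
    (hxy : outputs A C x = outputs B E y) : x = 0 := by
  obtain ⟨u, v, huv⟩ := isCoprime_charpoly h
  have hz : Polynomial.aeval A B.charpoly *ᵥ x = 0 := by
    refine hA.eq_zero fun s hs => ?_
    have h0 : (E * B ^ s) *ᵥ (Polynomial.aeval B B.charpoly *ᵥ y) = 0 := by
      rw [aeval_self_charpoly, zero_mulVec, mulVec_zero]
    rw [mulVec_aeval] at h0 ⊢
    rw [← h0]
    refine Finset.sum_congr rfl fun t ht => ?_
    -- Here `s ≤ n - 1` and `t ≤ n`: this is why windows have length `2 n`.
    have ht' : s + t < 2 * n := by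
      rw [charpoly_natDegree_eq_dim, Fintype.card_fin, Finset.mem_range] at ht
      omega
    have := congrFun hxy ⟨s + t, ht'⟩
    rw [outputs_apply, outputs_apply] at this
    rw [this]
  have h1 := congrArg (fun M => M *ᵥ x) (congrArg (Polynomial.aeval A) huv)
  simp only [map_add, map_mul, aeval_self_charpoly, mul_zero, zero_add, map_one, one_mulVec] at h1
  rw [← h1, ← mulVec_mulVec, hz, mulVec_zero]

lemma ker_outputs_eq_bot {A : Matrix (Fin n) (Fin n) ℝ} {C : Matrix (Fin m) (Fin n) ℝ}
    (hA : IsObservable A C) : (outputs A C).ker = ⊥ := by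
  rw [LinearMap.ker_eq_bot']
  intro x hx
  exact hA.eq_zero fun t ht => congrFun hx ⟨t, by omega⟩

/-- Outputs compatible with two different modes up to an error `b` are bounded. -/
lemma exists_norm_le_of_infDist_le {A B : Matrix (Fin n) (Fin n) ℝ}
    {C E : Matrix (Fin m) (Fin n) ℝ} (hA : IsObservable A C) (hB : IsObservable B E)
    (h : eigenvalueSet A ∩ eigenvalueSet B = ∅) (b : ℝ) :
    ∃ M : ℝ, ∀ v, Metric.infDist v (Set.range (outputs A C)) ≤ b →
      Metric.infDist v (Set.range (outputs B E)) ≤ b → ‖v‖ ≤ M := by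
  have hker : ((outputs A C).coprod (-outputs B E)).ker = ⊥ := by
    rw [LinearMap.ker_eq_bot']
    rintro ⟨x, y⟩ hxy
    have hxy' : outputs A C x = outputs B E y := by
      rw [LinearMap.coprod_apply, LinearMap.neg_apply, add_neg_eq_zero] at hxy
      exact hxy
    rw [eq_zero_of_outputs_eq hA h hxy',
      eq_zero_of_outputs_eq hB (by rwa [Set.inter_comm]) hxy'.symm]
    rfl
  -- In finite dimension, injectivity of `(x, y) ↦ outputs A C x - outputs B E y` bounds `(x, y)` by
  -- the mismatch of the outputs.
  obtain ⟨K, hK, hanti⟩ := LinearMap.exists_antilipschitzWith _ hker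
  let T := (outputs A C).toContinuousLinearMap
  -- The slack `b + 1` yields actual points of the ranges near `v`, without appealing to attainment
  -- of the infimum.
  refine ⟨(b + 1) + ‖T‖ * (K * (2 * (b + 1))), fun v h1 h2 => ?_⟩
  obtain ⟨_, ⟨x, rfl⟩, hx⟩ := (Metric.infDist_lt_iff (Set.range_nonempty _)).1
    (h1.trans_lt (lt_add_one b))
  obtain ⟨_, ⟨y, rfl⟩, hy⟩ := (Metric.infDist_lt_iff (Set.range_nonempty _)).1
    (h2.trans_lt (lt_add_one b))
  have h3 : ‖(x, y)‖ ≤ K * (2 * (b + 1)) := by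
    have := hanti.le_mul_dist (x, y) 0
    rw [map_zero, dist_zero_right, dist_zero_right] at this
    refine this.trans ?_
    gcongr
    rw [LinearMap.coprod_apply, LinearMap.neg_apply, ← sub_eq_add_neg, ← dist_eq_norm]
    have := dist_triangle_left (outputs A C x) (outputs B E y) v
    linarith
  calc ‖v‖ ≤ ‖v - outputs A C x‖ + ‖outputs A C x‖ := by
        simpa using norm_add_le (v - outputs A C x) (outputs A C x)
    _ ≤ (b + 1) + ‖T‖ * ‖x‖ := by
        rw [← dist_eq_norm]
        exact add_le_add hx.le (T.le_opNorm x)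
    _ ≤ _ := by
        gcongr
        exact (norm_fst_le (x, y)).trans h3

lemma exists_forall_norm_le_of_infDist_le {l : ℕ} {A : Fin l → Matrix (Fin n) (Fin n) ℝ}
    {C : Fin l → Matrix (Fin m) (Fin n) ℝ} (hobs : ∀ i, IsObservable (A i) (C i))
    (hdisj : ∀ i j, i ≠ j → eigenvalueSet (A i) ∩ eigenvalueSet (A j) = ∅) (b : ℝ) :
    ∃ M : ℝ, ∀ v i j, Metric.infDist v (Set.range (outputs (A i) (C i))) ≤ b →
      Metric.infDist v (Set.range (outputs (A j) (C j))) ≤ b → M < ‖v‖ → i = j := by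
  choose M hM using fun p : {p : Fin l × Fin l // p.1 ≠ p.2} =>
    exists_norm_le_of_infDist_le (hobs p.1.1) (hobs p.1.2) (hdisj _ _ p.2) b
  refine ⟨∑ p, |M p|, fun v i j hi hj hv => ?_⟩
  by_contra hij
  refine hv.not_ge ((hM ⟨(i, j), hij⟩ v hi hj).trans ((le_abs_self _).trans ?_))
  exact Finset.single_le_sum (f := fun p => |M p|) (fun p _ => abs_nonneg _) (Finset.mem_univ _)

end PairObservability

/-! ### Boundedness of the covariance along a mode sequence. -/

section Path

variable {n m l : ℕ} {A : Fin l → Matrix (Fin n) (Fin n) ℝ} {C : Fin l → Matrix (Fin m) (Fin n) ℝ}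
  {Q : Matrix (Fin n) (Fin n) ℝ} {R : Matrix (Fin m) (Fin m) ℝ} {P₀ : Matrix (Fin n) (Fin n) ℝ}
  {σ : ℕ → Fin l} {κ : ℕ}

/-- The mode sequence `σ` can change only at the multiples of `κ`. -/
def ChangesOnlyAt (A : Fin l → Matrix (Fin n) (Fin n) ℝ) (C : Fin l → Matrix (Fin m) (Fin n) ℝ)
    (κ : ℕ) (σ : ℕ → Fin l) : Prop :=
  ∀ k : ℕ, ¬ κ ∣ (k + 1) → (A (σ (k + 1)), C (σ (k + 1))) = (A (σ k), C (σ k))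

lemma ChangesOnlyAt.eq_of_lt (h : ChangesOnlyAt A C κ σ) (j : ℕ) {t : ℕ} (ht : t < κ) :
    A (σ (κ * j + t)) = A (σ (κ * j)) ∧ C (σ (κ * j + t)) = C (σ (κ * j)) := by
  induction t with
  | zero => simp
  | succ t ih =>
    have h1 : ¬ κ ∣ κ * j + t + 1 := by
      rw [add_assoc, Nat.dvd_add_right (dvd_mul_right _ _)]
      exact Nat.not_dvd_of_pos_of_lt (Nat.succ_pos t) ht
    have h2 := Prod.ext_iff.1 (h _ h1)
    have h3 := ih (by omega)
    exact ⟨h2.1.trans h3.1, h2.2.trans h3.2⟩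

/-- The Kalman covariance of a hybrid system with observable modes is bounded. -/
lemma exists_priorCov_le (hobs : ∀ i, IsObservable (A i) (C i)) (hn : 0 < n) (hκ : 2 * n ≤ κ)
    (hQ : Q.PosSemidef) (hR : R.PosDef) (hP₀ : P₀.PosSemidef) (h : ChangesOnlyAt A C κ σ) :
    ∃ X : Matrix (Fin n) (Fin n) ℝ,
      ∀ k, priorCov (fun k => A (σ k)) (fun k => C (σ k)) Q R P₀ k ≤ X := by
  set Pr := priorCov (fun k => A (σ k)) (fun k => C (σ k)) Q R P₀ with hPr
  have hpsd : ∀ k, (Pr k).PosSemidef := posSemidef_priorCov hQ hR hP₀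
  choose K hK using fun i => (hobs i).exists_transition_eq_zero
  -- At `t = 0` the deadbeat gains have erased the covariance from the start of the window, leaving
  -- accumulated noise only. Later steps use gain `0`; summing over all modes makes the bound
  -- independent of `j`.
  have step : ∀ t, ∃ X : Matrix (Fin n) (Fin n) ℝ, X.PosSemidef ∧ ∀ j, Pr (κ * j + n + t) ≤ X := by
    intro t
    induction t with
    | zero =>
      have hW : ∀ i, (accumulatedCov (A i) (C i) Q R (K i) n).PosSemidef := fun i =>
        posSemidef_accumulatedCov _ _ hQ hR _ _
      refine ⟨∑ i, accumulatedCov (A i) (C i) Q R (K i) n,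
        posSemidef_sum _ fun i _ => hW i, fun j => ?_⟩
      have h1 := priorCov_add_le (A := fun k => A (σ k)) (C := fun k => C (σ k)) hQ hR hP₀ (κ * j)
        (K (σ (κ * j))) n fun s hs => h.eq_of_lt j (by omega)
      rw [hK, Matrix.zero_mul, Matrix.zero_mul, zero_add] at h1
      exact h1.trans (Finset.single_le_sum
        (f := fun i => accumulatedCov (A i) (C i) Q R (K i) n)
        (fun i _ => Matrix.nonneg_iff_posSemidef.2 (hW i)) (Finset.mem_univ _))
    | succ t ih =>
      obtain ⟨X, hX, hXj⟩ := ih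
      have hW : ∀ i, (josephUpdate (A i) (C i) Q R 0 X).PosSemidef := fun i =>
        posSemidef_josephUpdate _ _ hQ hR hX _
      refine ⟨∑ i, josephUpdate (A i) (C i) Q R 0 X, posSemidef_sum _ fun i _ => hW i,
        fun j => ?_⟩
      exact (priorCov_succ_le hQ hR hP₀ _ (hXj j) 0).trans (Finset.single_le_sum
        (f := fun i => josephUpdate (A i) (C i) Q R 0 X)
        (fun i _ => Matrix.nonneg_iff_posSemidef.2 (hW i)) (Finset.mem_univ _))
  choose X hX hXj using step
  have hX0 : ∀ t, 0 ≤ X t := fun t => Matrix.nonneg_iff_posSemidef.2 (hX t)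
  have hP0 : ∀ k, 0 ≤ Pr k := fun k => Matrix.nonneg_iff_posSemidef.2 (hpsd k)
  -- Every `k ≥ n` is `κ * j + n + t` with `t < κ`; the second sum covers `k < n`.
  refine ⟨∑ t ∈ Finset.range κ, X t + ∑ k ∈ Finset.range n, Pr k, fun k => ?_⟩
  rcases lt_or_ge k n with hk | hk
  · exact (Finset.single_le_sum (f := Pr) (fun k _ => hP0 k) (Finset.mem_range.2 hk)).trans
      (le_add_of_nonneg_left (Finset.sum_nonneg fun t _ => hX0 t))
  · have h1 := hXj ((k - n) % κ) ((k - n) / κ)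
    have h2 : κ * ((k - n) / κ) + n + (k - n) % κ = k := by
      have := Nat.div_add_mod (k - n) κ
      omega
    rw [h2] at h1
    exact h1.trans ((Finset.single_le_sum (f := X) (fun k _ => hX0 k)
      (Finset.mem_range.2 (Nat.mod_lt _ (by omega)))).trans
      (le_add_of_nonneg_right (Finset.sum_nonneg fun t _ => hP0 t)))

end Path

/-! ### Consequences of a bounded residue bias. -/

section Bias

variable {n m r : ℕ} {A : ℕ → Matrix (Fin n) (Fin n) ℝ} {C : ℕ → Matrix (Fin m) (Fin n) ℝ}
  {Q : Matrix (Fin n) (Fin n) ℝ} {R : Matrix (Fin m) (Fin m) ℝ} {P₀ : Matrix (Fin n) (Fin n) ℝ}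
  {D : Matrix (Fin m) (Fin r) ℝ} {d : ℕ → Fin r → ℝ}

lemma errorBias_succ (k : ℕ) :
    errorBias A C Q R P₀ D d (k + 1) = A k *ᵥ errorBias A C Q R P₀ D d k -
      gain A C Q R P₀ (k + 1) *ᵥ rawResidueBias A C Q R P₀ D d (k + 1) := by
  simp only [errorBias, rawResidueBias, mulVec_add, mulVec_mulVec, sub_mulVec, Matrix.mul_assoc,
    sub_sub]

/-- Expresses the residue through the a posteriori bias at the same time `k`, so that `D d_k` can be
compared with `C_k Δe_k`, including at `k = 0`. -/
lemma rawResidueBias_eq (k : ℕ) :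
    rawResidueBias A C Q R P₀ D d k = C k *ᵥ errorBias A C Q R P₀ D d k +
      C k *ᵥ (gain A C Q R P₀ k *ᵥ rawResidueBias A C Q R P₀ D d k) + D *ᵥ d k := by
  cases k with
  | zero => simp [errorBias, rawResidueBias, mulVec_neg]
  | succ k =>
    rw [errorBias_succ, mulVec_sub, sub_add_cancel, mulVec_mulVec]
    rfl

/-- A bounded residue bias leaves the filter only bounded corrections, once the covariance and the
output matrices are bounded. -/
lemma exists_bound_of_residueBias_bounded (hQ : Q.PosSemidef) (hR : R.PosDef) (hP₀ : P₀.PosSemidef)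
    {X : Matrix (Fin n) (Fin n) ℝ} (hX : ∀ k, priorCov A C Q R P₀ k ≤ X)
    {c : ℝ} (hc : 0 ≤ c) (hC : ∀ k v, ‖C k *ᵥ v‖ ≤ c * ‖v‖) (hCt : ∀ k v, ‖(C k)ᵀ *ᵥ v‖ ≤ c * ‖v‖)
    {b : ℝ} (hb : ∀ k, ‖residueBias A C Q R P₀ D d k‖ ≤ b) :
    ∃ b', (∀ k, ‖A k *ᵥ errorBias A C Q R P₀ D d k - errorBias A C Q R P₀ D d (k + 1)‖ ≤ b') ∧
      ∀ k, ‖D *ᵥ d k + C k *ᵥ errorBias A C Q R P₀ D d k‖ ≤ b' := by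
  have hb0 : 0 ≤ b := (norm_nonneg _).trans (hb 0)
  have hP := posSemidef_priorCov (A := A) (C := C) hQ hR hP₀
  obtain ⟨p, hp⟩ := exists_norm_mulVec_le_of_le X
  obtain ⟨q, hq0, hq⟩ := exists_norm_mulVec_le X
  obtain ⟨ρ, hρ0, hρ⟩ := exists_norm_mulVec_le R
  obtain ⟨γ, hγ0, hγ⟩ := exists_norm_sq_le_of_posDef hR
  set e := errorBias A C Q R P₀ D d
  set w := rawResidueBias A C Q R P₀ D d with hw
  set z := residueBias A C Q R P₀ D d
  set S := fun k => innovationCov (C k) R (priorCov A C Q R P₀ k) with hS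
  have hSd : ∀ k, (S k).PosDef := fun k => posDef_innovationCov _ hR (hP k)
  have hSu : ∀ k, IsUnit (S k).det := fun k => (Matrix.isUnit_iff_isUnit_det _).1 (hSd k).isUnit
  have hwz : ∀ k, w k = CFC.sqrt (S k) *ᵥ z k := fun k => by
    have hu := (Matrix.isUnit_iff_isUnit_det _).1 (isUnit_sqrt (hSd k))
    change w k = CFC.sqrt (S k) *ᵥ ((CFC.sqrt (S k))⁻¹ *ᵥ w k)
    rw [mulVec_mulVec, mul_nonsing_inv _ hu, one_mulVec]
  -- From `w = S^{1/2} z`: `w ⬝ w = z ⬝ S z`, with `S ≤ C X Cᵀ + R`.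
  obtain ⟨w₀, hw₀⟩ : ∃ w₀, ∀ k, ‖w k‖ ≤ w₀ := by
    refine ⟨√(m * (b * ((c * (q * (c * b))) + ρ * b))), fun k => Real.le_sqrt_of_sq_le ?_⟩
    refine (norm_sq_le_dotProduct _).trans ?_
    rw [hwz, sqrt_mulVec_dotProduct (hSd k).posSemidef]
    have h1 : S k ≤ C k * X * (C k)ᵀ + R := by
      simp only [hS, innovationCov]
      gcongr
      exact conj_mono (hX k) _
    refine (dotProduct_mulVec_mono h1 _).trans ((dotProduct_le_norm_mul_norm _ _).trans ?_)
    rw [add_mulVec, ← mulVec_mulVec, ← mulVec_mulVec]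
    gcongr
    · exact hb k
    · refine (norm_add_le _ _).trans (add_le_add ?_ ?_)
      · refine (hC k _).trans ?_
        gcongr
        refine (hq _).trans ?_
        gcongr
        refine (hCt k _).trans ?_
        gcongr
        exact hb k
      · refine (hρ _).trans ?_
        gcongr
        exact hb k
  -- For `v = S⁻¹ w` one has `v ⬝ R v ≤ v ⬝ S v = z ⬝ z`, and `R` is positive definite.
  obtain ⟨v₀, hv₀⟩ : ∃ v₀, ∀ k, ‖(S k)⁻¹ *ᵥ w k‖ ≤ v₀ := by
    refine ⟨√(γ * (m * (b * b))), fun k => Real.le_sqrt_of_sq_le ((hγ _).trans ?_)⟩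
    gcongr
    set v := (S k)⁻¹ *ᵥ w k
    have hSv : S k *ᵥ v = w k := by rw [mulVec_mulVec, mul_nonsing_inv _ (hSu k), one_mulVec]
    have hzv : z k = CFC.sqrt (S k) *ᵥ v := by
      have hu := (Matrix.isUnit_iff_isUnit_det _).1 (isUnit_sqrt (hSd k))
      change (CFC.sqrt (S k))⁻¹ *ᵥ w k = _
      have hss := sqrt_mul_self_of_posSemidef (hSd k).posSemidef
      rw [← hSv, ← congrArg (· *ᵥ v) hss, ← mulVec_mulVec, mulVec_mulVec, nonsing_inv_mul _ hu,
        one_mulVec]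
    have hRS : R ≤ S k := le_add_of_nonneg_left
      (Matrix.nonneg_iff_posSemidef.2 (posSemidef_conj (hP k) _))
    refine (dotProduct_mulVec_mono hRS v).trans ?_
    rw [← sqrt_mulVec_dotProduct (hSd k).posSemidef, ← hzv]
    refine (dotProduct_le_norm_mul_norm _ _).trans ?_
    gcongr <;> exact hb k
  have hv₀0 : 0 ≤ v₀ := (norm_nonneg _).trans (hv₀ 0)
  obtain ⟨u₀, hu₀⟩ : ∃ u₀, ∀ k, ‖gain A C Q R P₀ k *ᵥ w k‖ ≤ u₀ := by
    refine ⟨|p| * (c * v₀), fun k => ?_⟩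
    rw [gain, kalmanGain, ← mulVec_mulVec, ← mulVec_mulVec]
    refine (hp _ (hP k) (hX k) _).trans ?_
    gcongr
    · exact le_abs_self p
    · refine (hCt k _).trans ?_
      gcongr
      exact hv₀ k
  have hu₀0 : 0 ≤ u₀ := (norm_nonneg _).trans (hu₀ 0)
  have hw₀0 : 0 ≤ w₀ := (norm_nonneg _).trans (hw₀ 0)
  refine ⟨u₀ + (w₀ + c * u₀), fun k => ?_, fun k => ?_⟩
  · have : A k *ᵥ e k - e (k + 1) = gain A C Q R P₀ (k + 1) *ᵥ w (k + 1) := by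
      rw [sub_eq_iff_eq_add', ← sub_eq_iff_eq_add]
      exact (errorBias_succ k).symm
    rw [this]
    have := mul_nonneg hc hu₀0
    linarith [hu₀ (k + 1)]
  · have : D *ᵥ d k + C k *ᵥ e k = w k - C k *ᵥ (gain A C Q R P₀ k *ᵥ w k) := by
      have := rawResidueBias_eq (A := A) (C := C) (Q := Q) (R := R) (P₀ := P₀) (D := D) (d := d) k
      rw [eq_sub_iff_add_eq]
      conv_rhs => rw [hw, this]
      abel
    rw [this]
    refine (norm_sub_le _ _).trans ?_
    have h1 : ‖C k *ᵥ (gain A C Q R P₀ k *ᵥ w k)‖ ≤ c * u₀ := (hC k _).trans (by gcongr; exact hu₀ k)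
    linarith [hw₀ k]

end Bias

/-! ### Limsup of Euclidean norms versus sup-norm bounds. -/

section Limsup

variable {n : ℕ}

lemma norm_le_norm_toLp (v : Fin n → ℝ) :
    ‖v‖ ≤ ‖(WithLp.toLp 2 v : EuclideanSpace ℝ (Fin n))‖ :=
  (pi_norm_le_iff_of_nonneg (norm_nonneg _)).2 fun i =>
    PiLp.norm_apply_le (WithLp.toLp 2 v : EuclideanSpace ℝ (Fin n)) i

lemma exists_norm_le_of_not_limsupNormEqTop {x : ℕ → Fin n → ℝ} (h : ¬ LimsupNormEqTop x) :
    ∃ b, ∀ k, ‖x k‖ ≤ b := by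
  obtain ⟨c, hc, hc'⟩ := exists_between (lt_top_iff_ne_top.2 h)
  have hev := eventually_lt_of_limsup_lt hc
  have hbd : IsBoundedUnder (· ≤ ·) atTop fun k => ‖x k‖ := by
    refine ⟨c.toReal, eventually_map.2 (hev.mono fun k hk => (norm_le_norm_toLp _).trans ?_)⟩
    rw [← toReal_enorm]
    exact ENNReal.toReal_mono hc'.ne hk.le
  obtain ⟨b, hb⟩ := hbd.bddAbove_range
  exact ⟨b, fun k => hb ⟨k, rfl⟩⟩

lemma not_limsupNormEqTop_of_norm_le {x : ℕ → Fin n → ℝ} {b : ℝ} (h : ∀ k, ‖x k‖ ≤ b) :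
    ¬ LimsupNormEqTop x := by
  let T := (EuclideanSpace.equiv (Fin n) ℝ).symm.toContinuousLinearMap
  have hle : ∀ k, ‖(WithLp.toLp 2 (x k) : EuclideanSpace ℝ (Fin n))‖ₑ ≤ ENNReal.ofReal (‖T‖ * b) := by
    intro k
    rw [← ofReal_norm]
    refine ENNReal.ofReal_le_ofReal ((T.le_opNorm (x k)).trans ?_)
    gcongr
    exact h k
  intro htop
  have : limsup (fun k => ‖(WithLp.toLp 2 (x k) : EuclideanSpace ℝ (Fin n))‖ₑ) atTop ≤
      ENNReal.ofReal (‖T‖ * b) := limsup_le_of_le (h := Eventually.of_forall hle)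
  rw [htop] at this
  exact ENNReal.ofReal_ne_top (top_le_iff.1 this)

end Limsup

/-! ### Attack windows and mode outputs. -/

section Windows

variable {n m r l : ℕ} {A : Fin l → Matrix (Fin n) (Fin n) ℝ} {C : Fin l → Matrix (Fin m) (Fin n) ℝ}
  {σ : ℕ → Fin l} {κ : ℕ}

/-- The attack vectors `D d_k` over the `2 n` steps that start at time `κ j`. -/
def attackWindow (n : ℕ) (D : Matrix (Fin m) (Fin r) ℝ) (κ : ℕ) (d : ℕ → Fin r → ℝ) (j : ℕ) :
    Fin (2 * n) → Fin m → ℝ :=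
  fun t => D *ᵥ d (κ * j + t)

/-- One-step errors are amplified at most `κ` times within a window where the mode is constant, so
the bound is uniform in `j`. -/
lemma exists_norm_sub_pow_mulVec_le (h : ChangesOnlyAt A C κ σ) {e : ℕ → Fin n → ℝ} {b : ℝ}
    (he : ∀ k, ‖A (σ k) *ᵥ e k - e (k + 1)‖ ≤ b) :
    ∃ b', ∀ j, ∀ t < κ, ‖e (κ * j + t) - (A (σ (κ * j)) ^ t) *ᵥ e (κ * j)‖ ≤ b' := by
  obtain ⟨α, hα, hA⟩ := exists_norm_mulVec_le_of_finite A
  have step : ∀ t, ∃ b', t < κ →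
      ∀ j, ‖e (κ * j + t) - (A (σ (κ * j)) ^ t) *ᵥ e (κ * j)‖ ≤ b' := by
    intro t
    induction t with
    | zero => exact ⟨0, fun _ j => by simp⟩
    | succ t ih =>
      obtain ⟨b', hb'⟩ := ih
      refine ⟨α * b' + b, fun ht j => ?_⟩
      have h1 := he (κ * j + t)
      rw [(h.eq_of_lt j (show t < κ by omega)).1] at h1
      have h2 : e (κ * j + (t + 1)) - (A (σ (κ * j)) ^ (t + 1)) *ᵥ e (κ * j) =
          A (σ (κ * j)) *ᵥ (e (κ * j + t) - (A (σ (κ * j)) ^ t) *ᵥ e (κ * j)) -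
            (A (σ (κ * j)) *ᵥ e (κ * j + t) - e (κ * j + t + 1)) := by
        rw [mulVec_sub, mulVec_mulVec, pow_succ', ← add_assoc]
        abel
      rw [h2]
      refine (norm_sub_le _ _).trans (add_le_add ((hA _ _).trans ?_) h1)
      gcongr
      exact hb' (by omega) j
  choose B hB using step
  refine ⟨∑ t ∈ Finset.range κ, |B t|, fun j t ht => (hB t ht j).trans ((le_abs_self _).trans ?_)⟩
  exact Finset.single_le_sum (f := fun t => |B t|) (fun t _ => abs_nonneg _) (Finset.mem_range.2 ht)

lemma exists_norm_attackWindow_add_outputs_le (hκ : 2 * n ≤ κ) (h : ChangesOnlyAt A C κ σ)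
    {D : Matrix (Fin m) (Fin r) ℝ} {d : ℕ → Fin r → ℝ} {e : ℕ → Fin n → ℝ} {b : ℝ}
    (he : ∀ k, ‖A (σ k) *ᵥ e k - e (k + 1)‖ ≤ b)
    (hd : ∀ k, ‖D *ᵥ d k + C (σ k) *ᵥ e k‖ ≤ b) :
    ∃ b', ∀ j, ‖attackWindow n D κ d j +
      outputs (A (σ (κ * j))) (C (σ (κ * j))) (e (κ * j))‖ ≤ b' := by
  obtain ⟨b₁, hb₁⟩ := exists_norm_sub_pow_mulVec_le h he
  obtain ⟨c, hc, hC⟩ := exists_norm_mulVec_le_of_finite C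
  refine ⟨|b| + c * |b₁|, fun j => (pi_norm_le_iff_of_nonneg (by positivity)).2 fun t => ?_⟩
  have ht : (t : ℕ) < κ := lt_of_lt_of_le t.2 hκ
  have h1 := hd (κ * j + t)
  rw [(h.eq_of_lt j ht).2] at h1
  have h2 : (attackWindow n D κ d j + outputs (A (σ (κ * j))) (C (σ (κ * j))) (e (κ * j))) t =
      (D *ᵥ d (κ * j + t) + C (σ (κ * j)) *ᵥ e (κ * j + t)) -
        C (σ (κ * j)) *ᵥ (e (κ * j + t) - (A (σ (κ * j)) ^ (t : ℕ)) *ᵥ e (κ * j)) := by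
    rw [Pi.add_apply, outputs_apply, mulVec_sub, mulVec_mulVec, attackWindow]
    abel
  rw [h2]
  refine (norm_sub_le _ _).trans (add_le_add (h1.trans (le_abs_self b)) ((hC _ _).trans ?_))
  gcongr
  exact (hb₁ j t ht).trans (le_abs_self _)

/-- If the state stays close to the trajectory of the current mode and is unbounded, then so are the
attack windows. -/
lemma frequently_lt_norm_attackWindow (hobs : ∀ i, IsObservable (A i) (C i)) (hκ0 : 0 < κ)
    (h : ChangesOnlyAt A C κ σ) {D : Matrix (Fin m) (Fin r) ℝ} {d : ℕ → Fin r → ℝ}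
    {e : ℕ → Fin n → ℝ} {b b' : ℝ} (he : ∀ k, ‖A (σ k) *ᵥ e k - e (k + 1)‖ ≤ b)
    (hd : ∀ j, ‖attackWindow n D κ d j +
      outputs (A (σ (κ * j))) (C (σ (κ * j))) (e (κ * j))‖ ≤ b')
    (hunb : LimsupNormEqTop e) (M : ℝ) : ∃ᶠ j in atTop, M < ‖attackWindow n D κ d j‖ := by
  intro hcon
  have hbd : IsBoundedUnder (· ≤ ·) atTop fun j => ‖attackWindow n D κ d j‖ :=
    ⟨M, eventually_map.2 (hcon.mono fun j hj => not_lt.1 hj)⟩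
  obtain ⟨w, hw⟩ := hbd.bddAbove_range
  have hw' : ∀ j, ‖attackWindow n D κ d j‖ ≤ w := fun j => hw ⟨j, rfl⟩
  -- Were the windows bounded, so would be the outputs, hence by observability the states at times
  -- `κ * j`, hence all states.
  choose K _ hanti using fun i =>
    LinearMap.exists_antilipschitzWith (outputs (A i) (C i)) (ker_outputs_eq_bot (hobs i))
  have hout : ∀ j, ‖outputs (A (σ (κ * j))) (C (σ (κ * j))) (e (κ * j))‖ ≤ b' + w := fun j => by
    refine (le_of_eq (congrArg norm ?_)).trans
      ((norm_sub_le _ (attackWindow n D κ d j)).trans (add_le_add (hd j) (hw' j)))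
    abel
  have hbw : 0 ≤ b' + w := (norm_nonneg _).trans (hout 0)
  have he0 : ∀ j, ‖e (κ * j)‖ ≤ (∑ i, (K i : ℝ)) * (b' + w) := fun j => by
    have h1 := (hanti (σ (κ * j))).le_mul_dist (e (κ * j)) 0
    rw [map_zero, dist_zero_right, dist_zero_right] at h1
    refine h1.trans (mul_le_mul ?_ (hout j) (norm_nonneg _)
      (Finset.sum_nonneg fun i _ => (K i).coe_nonneg))
    exact Finset.single_le_sum (f := fun i => (K i : ℝ)) (fun i _ => (K i).coe_nonneg)
      (Finset.mem_univ _)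
  obtain ⟨b₁, hb₁⟩ := exists_norm_sub_pow_mulVec_le h he
  choose α hα hA using fun t => exists_norm_mulVec_le_of_finite fun i => A i ^ t
  refine not_limsupNormEqTop_of_norm_le (x := e)
    (b := b₁ + (∑ t ∈ Finset.range κ, α t) * ((∑ i, (K i : ℝ)) * (b' + w))) (fun k => ?_) hunb
  have hk : k % κ < κ := Nat.mod_lt _ hκ0
  have h1 := hb₁ (k / κ) (k % κ) hk
  rw [Nat.div_add_mod] at h1
  have h2 : ‖e k‖ ≤ _ := norm_le_norm_sub_add (e k) ((A (σ (κ * (k / κ))) ^ (k % κ)) *ᵥ e (κ * (k / κ)))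
  refine h2.trans (add_le_add h1 ((hA (k % κ) _ _).trans (mul_le_mul ?_ (he0 _) (norm_nonneg _)
    (Finset.sum_nonneg fun t _ => hα t))))
  exact Finset.single_le_sum (f := α) (fun t _ => hα t) (Finset.mem_range.2 hk)

end Windows

/-! ### Stealthy attacks have probability zero. -/

section Unpredictability

variable {n m r l : ℕ} (A : Fin l → Matrix (Fin n) (Fin n) ℝ) (C : Fin l → Matrix (Fin m) (Fin n) ℝ)

/-- The attacks and mode sequences for which infinitely many attack windows exceed `M`, and each of
those is compatible with the current mode up to an error `b`. -/
def stealthySet (D : Matrix (Fin m) (Fin r) ℝ) (κ : ℕ) (M b : ℝ) :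
    Set ((ℕ → Fin r → ℝ) × (ℕ → Fin l)) :=
  {p | (∃ᶠ j in atTop, M < ‖attackWindow n D κ p.1 j‖) ∧
    ∀ j, M < ‖attackWindow n D κ p.1 j‖ →
      Metric.infDist (attackWindow n D κ p.1 j)
        (Set.range (outputs (A (p.2 (κ * j))) (C (p.2 (κ * j))))) ≤ b}

lemma measurable_attackWindow (D : Matrix (Fin m) (Fin r) ℝ) (κ j : ℕ) :
    Measurable fun d : ℕ → Fin r → ℝ => attackWindow n D κ d j := by
  refine measurable_pi_lambda _ fun t => ?_
  have : Continuous fun v : Fin r → ℝ => D *ᵥ v := by fun_prop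
  exact this.measurable.comp (measurable_pi_apply _)

/-- A countable discrete index lets measurability be checked for one set at a time, where the
distance is continuous. -/
lemma measurable_infDist_of_countable {Ω V ι : Type*} [MeasurableSpace Ω] [PseudoMetricSpace V]
    [MeasurableSpace V] [OpensMeasurableSpace V] [Countable ι] [MeasurableSpace ι]
    [MeasurableSingletonClass ι] (S : ι → Set V) {f : Ω → V} {g : Ω → ι} (hf : Measurable f)
    (hg : Measurable g) : Measurable fun q => Metric.infDist (f q) (S (g q)) := by
  have h1 : Measurable fun q : V × ι => Metric.infDist q.1 (S q.2) :=
    measurable_from_prod_countable_left fun i => (Metric.continuous_infDist_pt (S i)).measurable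
  have h2 := h1.comp (hf.prodMk hg)
  simpa only [Function.comp_def] using h2

lemma measurable_infDist_outputs (D : Matrix (Fin m) (Fin r) ℝ) (κ j : ℕ) :
    Measurable fun p : (ℕ → Fin r → ℝ) × (ℕ → Fin l) =>
      Metric.infDist (attackWindow n D κ p.1 j)
        (Set.range (outputs (A (p.2 (κ * j))) (C (p.2 (κ * j))))) :=
  measurable_infDist_of_countable (fun i => Set.range (outputs (A i) (C i)))
    ((measurable_attackWindow D κ j).comp measurable_fst)
    ((measurable_pi_apply (κ * j)).comp measurable_snd)

lemma measurableSet_lt_norm_attackWindow (D : Matrix (Fin m) (Fin r) ℝ) (κ : ℕ) (M : ℝ) (j : ℕ) :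
    MeasurableSet {p : (ℕ → Fin r → ℝ) × (ℕ → Fin l) | M < ‖attackWindow n D κ p.1 j‖} :=
  measurableSet_lt measurable_const ((measurable_attackWindow D κ j).comp measurable_fst).norm

lemma measurableSet_stealthySet (D : Matrix (Fin m) (Fin r) ℝ) (κ : ℕ) (M b : ℝ) :
    MeasurableSet (stealthySet A C D κ M b) := by
  have hlarge := measurableSet_lt_norm_attackWindow (n := n) (l := l) D κ M
  have hfreq : MeasurableSet {p : (ℕ → Fin r → ℝ) × (ℕ → Fin l) |
      ∃ᶠ j in atTop, M < ‖attackWindow n D κ p.1 j‖} := by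
    simp only [frequently_atTop]
    measurability
  have hcompat := fun j =>
    measurableSet_le (measurable_infDist_outputs A C D κ j) (measurable_const (a := b))
  have hset : stealthySet A C D κ M b =
      {p | ∃ᶠ j in atTop, M < ‖attackWindow n D κ p.1 j‖} ∩
        ⋂ j, {p | M < ‖attackWindow n D κ p.1 j‖ →
          Metric.infDist (attackWindow n D κ p.1 j)
            (Set.range (outputs (A (p.2 (κ * j))) (C (p.2 (κ * j))))) ≤ b} := by
    ext p
    simp [stealthySet]
  rw [hset]
  exact hfreq.inter (MeasurableSet.iInter fun j => (hlarge j).imp (hcompat j))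

variable {A C}

/-- Along a fixed attack, the mode sequences in the stealthy set follow a fixed sequence of modes at
fixed times. -/
lemma exists_strictMono_of_mem_stealthySet {D : Matrix (Fin m) (Fin r) ℝ} {κ : ℕ} (hκ : 0 < κ)
    {M b : ℝ} (hM : ∀ v i j, Metric.infDist v (Set.range (outputs (A i) (C i))) ≤ b →
      Metric.infDist v (Set.range (outputs (A j) (C j))) ≤ b → M < ‖v‖ → i = j)
    {d : ℕ → Fin r → ℝ} {τ : ℕ → Fin l} (hτ : (d, τ) ∈ stealthySet A C D κ M b) :
    ∃ ρ : ℕ → ℕ, StrictMono ρ ∧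
      ∀ τ', (d, τ') ∈ stealthySet A C D κ M b → ∀ k, τ' (ρ k) = τ (ρ k) := by
  have hinf := Nat.frequently_atTop_iff_infinite.1 hτ.1
  refine ⟨fun k => κ * Nat.nth (fun j => M < ‖attackWindow n D κ d j‖) k, fun a b hab =>
    Nat.mul_lt_mul_of_pos_left (Nat.nth_strictMono hinf hab) hκ, fun τ' hτ' k => ?_⟩
  have hk := Nat.nth_mem_of_infinite hinf k
  exact hM _ _ _ (hτ'.2 _ hk) (hτ.2 _ hk) hk

lemma measure_stealthySet_eq_zero {Ω : Type*} [MeasurableSpace Ω] {P : Measure Ω}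
    [IsProbabilityMeasure P] {σ : ℕ → Ω → Fin l} (hσ : ∀ k, Measurable (σ k))
    (hunpred : ∀ (g : ℕ → Fin l) (ρ : ℕ → ℕ), StrictMono ρ →
      P {ω | ∀ k, (A (σ (ρ k) ω), C (σ (ρ k) ω)) = (A (g k), C (g k))} = 0)
    {d : ℕ → Ω → Fin r → ℝ} (hd : ∀ k, Measurable (d k))
    (hindep : IndepFun (fun ω k => d k ω) (fun ω k => σ k ω) P)
    {D : Matrix (Fin m) (Fin r) ℝ} {κ : ℕ} (hκ : 0 < κ) {M b : ℝ}
    (hM : ∀ v i j, Metric.infDist v (Set.range (outputs (A i) (C i))) ≤ b →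
      Metric.infDist v (Set.range (outputs (A j) (C j))) ≤ b → M < ‖v‖ → i = j) :
    ∀ᵐ ω ∂P, ((fun k => d k ω), (fun k => σ k ω)) ∉ stealthySet A C D κ M b := by
  have hdm : Measurable fun ω k => d k ω := measurable_pi_lambda _ hd
  have hσm : Measurable fun ω k => σ k ω := measurable_pi_lambda _ hσ
  have hS := measurableSet_stealthySet A C D κ M b
  have hmap := (indepFun_iff_map_prod_eq_prod_map_map hdm.aemeasurable hσm.aemeasurable).1 hindep
  have : IsProbabilityMeasure (P.map fun ω k => σ k ω) :=
    Measure.isProbabilityMeasure_map hσm.aemeasurable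
  have hzero : ((P.map fun ω k => d k ω).prod (P.map fun ω k => σ k ω))
      (stealthySet A C D κ M b) = 0 := by
    -- By independence the joint law is a product, so it suffices that every section at a fixed
    -- attack `a` is null. A nonempty section lies in an event of `hunpred`, any one of its members
    -- serving as the prescribed sequence.
    rw [Measure.measure_prod_null hS]
    refine Eventually.of_forall fun a => ?_
    change (P.map fun ω k => σ k ω) (Prod.mk a ⁻¹' stealthySet A C D κ M b) = 0
    rw [Measure.map_apply hσm (measurable_prodMk_left hS)]
    by_cases hne : ∃ τ, (a, τ) ∈ stealthySet A C D κ M b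
    · obtain ⟨τ, hτ⟩ := hne
      obtain ⟨ρ, hρ, heq⟩ := exists_strictMono_of_mem_stealthySet hκ hM hτ
      refine measure_mono_null ?_ (hunpred (fun k => τ (ρ k)) ρ hρ)
      intro ω hω k
      have hk : σ (ρ k) ω = τ (ρ k) := heq _ hω k
      rw [hk]
    · convert measure_empty (μ := P)
      exact Set.eq_empty_of_forall_notMem fun ω hω => hne ⟨_, hω⟩
  rw [← hmap, Measure.map_apply (hdm.prodMk hσm) hS] at hzero
  exact measure_eq_zero_iff_ae_notMem.1 hzero

end Unpredictability

end HybridMovingTarget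

/-! ### The almost sure implication. -/

open HybridMovingTarget in
theorem theorem3 {Ω : Type*} [MeasurableSpace Ω] (P : MeasureTheory.Measure Ω)
    [MeasureTheory.IsProbabilityMeasure P] {n m l r : ℕ}
    (A : Fin l → Matrix (Fin n) (Fin n) ℝ) (C : Fin l → Matrix (Fin m) (Fin n) ℝ)
    (Q : Matrix (Fin n) (Fin n) ℝ) (hQ : Q.PosSemidef)
    (R : Matrix (Fin m) (Fin m) ℝ) (hR : R.PosDef)
    (P₀ : Matrix (Fin n) (Fin n) ℝ) (hP₀ : P₀.PosSemidef)
    (σ : ℕ → Ω → Fin l) (hσ : ∀ k, Measurable (σ k))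
    (hdesign : HybridMovingTarget.DesignRecommendations P A C σ)
    (s : Fin r ↪ Fin m) (d : ℕ → Ω → Fin r → ℝ) (hd : ∀ k, Measurable (d k))
    (hindep : ProbabilityTheory.IndepFun (fun ω k => d k ω) (fun ω k => σ k ω) P) :
    ∀ᵐ ω ∂P,
      HybridMovingTarget.LimsupNormEqTop
        (HybridMovingTarget.errorBias (fun k => A (σ k ω)) (fun k => C (σ k ω)) Q R P₀
          (HybridMovingTarget.attackMatrix s) (fun k => d k ω)) →
      HybridMovingTarget.LimsupNormEqTop
        (HybridMovingTarget.residueBias (fun k => A (σ k ω)) (fun k => C (σ k ω)) Q R P₀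
          (HybridMovingTarget.attackMatrix s) (fun k => d k ω)) := by
  -- For `n = 0` the period `κ` may vanish, but the error bias is trivially zero.
  rcases Nat.eq_zero_or_pos n with rfl | hn
  · refine Eventually.of_forall fun ω h => absurd h ?_
    exact not_limsupNormEqTop_of_norm_le (b := 0) fun k => by
      rw [Subsingleton.elim (errorBias _ _ _ _ _ _ _ k) 0, norm_zero]
  obtain ⟨κ, hκ, hper⟩ := hdesign.periodic_change
  have hκ0 : 0 < κ := by omega
  choose M hM using fun N : ℕ =>
    exists_forall_norm_le_of_infDist_le hdesign.observable hdesign.disjoint_eigenvalues (N : ℝ)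
  obtain ⟨c₁, hc₁, hC₁⟩ := exists_norm_mulVec_le_of_finite C
  obtain ⟨c₂, hc₂, hC₂⟩ := exists_norm_mulVec_le_of_finite fun i => (C i)ᵀ
  have hnull := ae_all_iff.2 fun N : ℕ => measure_stealthySet_eq_zero
    (D := attackMatrix s) hσ hdesign.unpredictable hd hindep hκ0 (hM N)
  filter_upwards [hper, hnull] with ω hω hnω hunb
  by_contra hbdd
  obtain ⟨b, hb⟩ := exists_norm_le_of_not_limsupNormEqTop hbdd
  have hch : ChangesOnlyAt A C κ fun k => σ k ω := hω
  obtain ⟨X, hX⟩ := exists_priorCov_le hdesign.observable hn hκ hQ hR hP₀ hch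
  obtain ⟨b₁, he, hde⟩ := exists_bound_of_residueBias_bounded (c := c₁ + c₂) hQ hR hP₀ hX
    (by positivity) (fun k v => (hC₁ _ v).trans (by gcongr; linarith))
    (fun k v => (hC₂ _ v).trans (by gcongr; linarith)) hb
  obtain ⟨b₂, hwin⟩ := exists_norm_attackWindow_add_outputs_le hκ hch he hde
  obtain ⟨N, hN⟩ := exists_nat_ge b₂
  refine hnω N ⟨frequently_lt_norm_attackWindow hdesign.observable hκ0 hch he hwin hunb _,
    fun j _ => ?_⟩
  -- A stealthy attack cancels the outputs of the bias, so the nearby output sequence starts at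
  -- `-Δe`.
  refine (Metric.infDist_le_dist_of_mem (Set.mem_range_self
    (-errorBias (fun k => A (σ k ω)) (fun k => C (σ k ω)) Q R P₀ (attackMatrix s)
      (fun k => d k ω) (κ * j)))).trans ?_
  rw [map_neg, dist_eq_norm, sub_neg_eq_add]
  exact (hwin j).trans hN
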